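/- Let $K$ be an infinite field, $K_s$ a separable closure of $K$ with Galois group $\mathrm{Gal}(K)=\mathrm{Gal}(K_s/K)$, and write $\mathrm{Gal}(L)=\mathrm{Gal}(K_s/L)$ for $K\subseteq L\subseteq K_s$. A *variety* over a field $F$ is a geometrically integral scheme of finite type over $F$. Valuations may be trivial, equivalent valuations are identified, and $\mathrm{Val}(L)$ is the space of valuations of $L$, whose topology has the subbasis of all sets $\{w : w(a)>0\}$ and $\{w : w(a)\ge 0\}$, $a\in L$. A *Henselian field-valuation structure* $\mathbf K=(K,X,K_x,v_x)_{x\in X}$ consists of a profinite space $X$ with a continuous right action $(x,\sigma)\mapsto x^\sigma$ of $\mathrm{Gal}(K)$ and, for each $x\in X$, a field $K\subseteq K_x\subseteq K_s$ and a Henselian valuation $v_x$ of $K_x$, such that: * for each finite separable extension $L\subseteq K_s$ of $K$ the set $X_L=\{x\in X : L\subseteq K_x\}$ is open in $X$, and the map $X_L\to\mathrm{Val}(L)$, $x\mapsto v_x|_L$, is continuous; * $K_{x^\sigma}=K_x^\sigma$ and $v_{x^\sigma}(u^\sigma)=v_x(u)$ for all $x\in X$, $\sigma\in\mathrm{Gal}(K)$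 and $u\in K_x$; * if $x^\sigma=x$, then $\sigma\in\mathrm{Gal}(K_x)$. A *special partition* is a family $(\mathrm{Gal}(L_i),X_i)_{i\in I_0}$ with $I_0$ finite, $X_i\subseteq X$ open-closed and $L_i\subseteq K_s$ a finite separable extension of $K$ such that $L_i\subseteq K_x$ for all $x\in X_i$, $\mathrm{Gal}(L_i)=\{\sigma\in\mathrm{Gal}(K) : X_i^\sigma=X_i\}$, and there are finite sets $R_i\subseteq\mathrm{Gal}(K)$ with disjoint unions $\mathrm{Gal}(K)=\bigsqcup_{\rho\in R_i}\mathrm{Gal}(L_i)\rho$ for each $i\in I_0$ and $X=\bigsqcup_{i\in I_0}\bigsqcup_{\rho\in R_i}X_i^\rho$. The *block approximation condition* says: for every special partition $(\mathrm{Gal}(L_i),X_i)_{i\in I_0}$, every smooth closed subvariety $V$ of some affine space $\mathbb A^n_K$, all points $\mathbf a_i\in V(L_i)$ and all $c_i\in K^\times$ ($i\in I_0$), there is $\mathbf a\in V(K)$ with $v_x(\mathbf a-\mathbf a_i)>v_x(c_i)$ for all $i\in I_0$ and $x\in X_i$. Here the value of a tuple is the minimum of the values of its coordinates. **Proposition 12.4.**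 Let $\mathbf K$ be a Henselian field-valuation structure over the infinite field $K$ which satisfies the block approximation condition. Then $\mathbf K$ is unirationally closed. That is, given a special partition $(\mathrm{Gal}(L_i),X_i)_{i\in I_0}$, a smooth affine variety $V$ over $K$ and, for each $i\in I_0$, a smooth variety $U_i$ over $L_i$ which is birationally equivalent over $L_i$ to $\mathbb A^{\dim V}_{L_i}$ and an étale $L_i$-morphism $\pi_i:U_i\to V\times_K L_i$, there are a point $\mathbf a\in V(K)$ and, for all $i\in I_0$ and $x\in X_i$, a point $\mathbf b_x\in U_i(K_x)$ with $\pi_i(\mathbf b_x)=\mathbf a$. -/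

import Mathlib

universe u v

namespace BlockApprox

section

open AlgebraicGeometry CategoryTheory CategoryTheory.Limits

/-- The absolute Galois group `Gal(K) = Gal(K_s/K)`. Its multiplication is composition, so a right
action `x ↦ x ^ σ` written with products "first `σ`, then `τ`" is the same thing as a left action
`x ↦ σ • x` of this group. -/
abbrev AbsGal (K : Type u) [Field K] : Type u :=
  SeparableClosure K ≃ₐ[K] SeparableClosure K

/-- The patch topology on the space `Val(L)` of all valuations of `L` (the trivial one included,
equivalent valuations identified, i.e. valuations are given by their valuation rings). A subbasis
consists of the sets `{w | w(a) > 0}` and `{w | w(a) ≥ 0}`, `a ∈ L` (in additive notation). -/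
abbrev patchTopology (L : Type u) [Field L] : TopologicalSpace (ValuationSubring L) :=
  TopologicalSpace.generateFrom
    ({U | ∃ a : L, U = {w | w.valuation a < 1}} ∪ {U | ∃ a : L, U = {w | w.valuation a ≤ 1}})

/-- A field structure `(K, X, K_x)_{x ∈ X}`: a profinite space `X` with a continuous action of
`Gal(K)` and, for each `x`, a separable algebraic extension `K_x` of `K` inside `K_s`. -/
structure FieldStructure (K : Type u) [Field K] (X : Type v) [TopologicalSpace X]
    [CompactSpace X] [T2Space X] [TotallyDisconnectedSpace X]
    [MulAction (AbsGal K) X] [ContinuousSMul (AbsGal K) X] where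
  /-- The local field `K_x`. -/
  field : X → IntermediateField K (SeparableClosure K)
  /-- The map `x ↦ K_x` is étale continuous: for each finite separable extension `L` of `K`, the
  set `{x | L ⊆ K_x}` is open. -/
  isOpen_setOf_le : ∀ L : IntermediateField K (SeparableClosure K), FiniteDimensional K L →
    IsOpen {x | L ≤ field x}
  field_smul : ∀ (σ : AbsGal K) (x : X),
    field (σ • x) = (field x).map (σ : SeparableClosure K →ₐ[K] SeparableClosure K)
  stabilizer_le : ∀ x : X, MulAction.stabilizer (AbsGal K) x ≤ (field x).fixingSubgroup

variable {K : Type u} [Field K] {X : Type v} [TopologicalSpace X]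
  [CompactSpace X] [T2Space X] [TotallyDisconnectedSpace X]
  [MulAction (AbsGal K) X] [ContinuousSMul (AbsGal K) X]

/-- A special partition `(Gal(L_i), X_i)_{i ∈ I_0}` of the group structure
`(Gal(K), X, Gal(K_x))_{x ∈ X}`. -/
structure SpecialPartition (S : FieldStructure K X) (ι : Type) where
  finite : Finite ι
  /-- The finite separable extension `L_i` of `K`. -/
  L : ι → IntermediateField K (SeparableClosure K)
  /-- The block `X_i`. -/
  block : ι → Set X
  isClopen_block : ∀ i, IsClopen (block i)
  finiteDimensional : ∀ i, FiniteDimensional K (L i)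
  le_field : ∀ i, ∀ x ∈ block i, L i ≤ S.field x
  mem_fixingSubgroup_iff : ∀ (i : ι) (σ : AbsGal K),
    σ ∈ (L i).fixingSubgroup ↔ (fun x ↦ σ • x) '' block i = block i
  /-- There are finite sets `R_i` of representatives of the cosets `ρ Gal(L_i)` such that `X` is
  the disjoint union of the sets `ρ • X_i` with `i ∈ I_0` and `ρ ∈ R_i`. -/
  exists_representatives : ∃ R : ι → Finset (AbsGal K),
    (∀ (i : ι) (σ : AbsGal K), ∃! ρ, ρ ∈ R i ∧ ρ⁻¹ * σ ∈ (L i).fixingSubgroup) ∧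
    (∀ x : X, ∃! p : ι × AbsGal K, p.2 ∈ R p.1 ∧ x ∈ (fun y ↦ p.2 • y) '' block p.1)

/-- A (absolutely irreducible) variety over a field `k`: a geometrically integral scheme of finite
type over `k`. -/
structure IsVariety {k : Type u} [Field k] {V : Scheme.{u}} (p : V ⟶ Spec (.of k)) : Prop where
  geometricallyIntegral : GeometricallyIntegral p
  locallyOfFiniteType : LocallyOfFiniteType p
  quasiCompact : QuasiCompact p

/-- A unirational arithmetical problem
`(V, X_i, L_i, π_i : U_i → V ×_K L_i)_{i ∈ I_0}` for a field structure. -/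
structure UnirationalProblem (S : FieldStructure K X) where
  ι : Type
  partition : SpecialPartition S ι
  V : Scheme.{u}
  /-- The structure morphism of the `K`-variety `V`. -/
  p : V ⟶ Spec (.of K)
  isAffine_V : IsAffine V
  isVariety_V : IsVariety p
  smooth_V : Smooth p
  /-- The dimension of `V`. -/
  dim : ℕ
  dim_eq : topologicalKrullDim V = dim
  U : ι → Scheme.{u}
  /-- The structure morphism of the `L_i`-variety `U_i`. -/
  q : ∀ i, U i ⟶ Spec (.of (partition.L i))
  isVariety_U : ∀ i, IsVariety (q i)
  smooth_U : ∀ i, Smooth (q i)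
  birational_U : ∀ i, Scheme.BirationalOver (q i)
    (𝔸(ULift.{u} (Fin dim); Spec (.of (partition.L i))) ↘ Spec (.of (partition.L i)))
  π : ∀ i, U i ⟶ pullback p (Spec.map (CommRingCat.ofHom (algebraMap K (partition.L i))))
  π_snd : ∀ i, π i ≫ pullback.snd _ _ = q i
  etale_π : ∀ i, Etale (π i)

/-- A solution of a unirational arithmetical problem: a point `a ∈ V(K)` and points
`b_x ∈ U_i(K_x)` with `π_i(b_x) = a`, for all `i ∈ I_0` and `x ∈ X_i`. -/
structure UnirationalProblem.Solution {S : FieldStructure K X} (Φ : UnirationalProblem S) where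
  a : Spec (.of K) ⟶ Φ.V
  a_over : a ≫ Φ.p = 𝟙 _
  b : ∀ i, ∀ x ∈ Φ.partition.block i, Spec (.of (S.field x)) ⟶ Φ.U i
  b_over : ∀ (i : Φ.ι) (x : X) (hx : x ∈ Φ.partition.block i), b i x hx ≫ Φ.q i =
    Spec.map (CommRingCat.ofHom
      (IntermediateField.inclusion (Φ.partition.le_field i x hx)).toRingHom)
  π_b : ∀ (i : Φ.ι) (x : X) (hx : x ∈ Φ.partition.block i),
    b i x hx ≫ Φ.π i ≫ pullback.fst _ _ =
      Spec.map (CommRingCat.ofHom (algebraMap K (S.field x))) ≫ a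

/-- A field structure is unirationally closed if each unirational arithmetical problem for it has
a solution. -/
def FieldStructure.UnirationallyClosed (S : FieldStructure K X) : Prop :=
  ∀ Φ : UnirationalProblem S, Nonempty Φ.Solution

variable (K X) in
/-- A field-valuation structure `(K, X, K_x, v_x)_{x ∈ X}`. -/
structure FieldValuationStructure extends FieldStructure K X where
  /-- The valuation ring of `v_x`. -/
  val : ∀ x : X, ValuationSubring (field x)
  /-- `v_{σ • x}(σ u) ≥ 0` if and only if `v_x(u) ≥ 0`; that is, `v_{σ • x}` is the transport of
  `v_x` by `σ`. -/
  val_smul : ∀ (σ : AbsGal K) (x : X) (u : field x) (hu : σ (u : SeparableClosure K) ∈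
    field (σ • x)), (⟨σ (u : SeparableClosure K), hu⟩ : field (σ • x)) ∈ val (σ • x) ↔ u ∈ val x
  /-- For each finite separable extension `L` of `K`, the map `x ↦ v_x|_L` from
  `X_L = {x | L ⊆ K_x}` to `Val(L)` is continuous. -/
  continuous_restrict : ∀ L : IntermediateField K (SeparableClosure K), FiniteDimensional K L →
    @Continuous {x : X // L ≤ field x} (ValuationSubring L) inferInstance (patchTopology L)
      (fun x ↦ (val x.1).comap (IntermediateField.inclusion x.2).toRingHom)

/-- The structure is Henselian if each `(K_x, v_x)` is a Henselian valued field. -/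
def FieldValuationStructure.IsHenselian (S : FieldValuationStructure K X) : Prop :=
  ∀ x : X, HenselianLocalRing (S.val x)

/-- A block approximation problem `(V, X_i, L_i, a_i, c_i)_{i ∈ I_0}` for a field-valuation
structure. Here `V` is a smooth affine variety over `K`, given as a closed subvariety of `𝔸ⁿ` by
its ideal, so that `V(F)` is the set of zeros of the ideal in `Fⁿ`. -/
structure BlockApproximationProblem (S : FieldValuationStructure K X) where
  ι : Type
  partition : SpecialPartition S.toFieldStructure ι
  n : ℕ
  /-- The ideal of `V ⊆ 𝔸ⁿ`. -/
  I : Ideal (MvPolynomial (Fin n) K)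
  isVariety_V :
    IsVariety (Spec.map (CommRingCat.ofHom (algebraMap K (MvPolynomial (Fin n) K ⧸ I))))
  smooth_V : Smooth (Spec.map (CommRingCat.ofHom (algebraMap K (MvPolynomial (Fin n) K ⧸ I))))
  a : ∀ i, Fin n → partition.L i
  a_mem : ∀ i, a i ∈ MvPolynomial.zeroLocus (partition.L i) I
  c : ι → K
  c_ne_zero : ∀ i, c i ≠ 0

/-- A solution of a block approximation problem: a point `b ∈ V(K)` with
`v_x(b - a_i) > v_x(c_i)` (in additive notation) for all `i ∈ I_0` and `x ∈ X_i`. The value of a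
tuple is the minimum of the values of its coordinates. -/
structure BlockApproximationProblem.Solution {S : FieldValuationStructure K X}
    (Φ : BlockApproximationProblem S) where
  b : Fin Φ.n → K
  b_mem : b ∈ MvPolynomial.zeroLocus K Φ.I
  approx : ∀ (i : Φ.ι) (x : X) (hx : x ∈ Φ.partition.block i) (j : Fin Φ.n),
    (S.val x).valuation (algebraMap K (S.field x) (b j) -
        IntermediateField.inclusion (Φ.partition.le_field i x hx) (Φ.a i j)) <
      (S.val x).valuation (algebraMap K (S.field x) (Φ.c i))

/-- The block approximation condition: each block approximation problem has a solution. -/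
def FieldValuationStructure.BlockApproximationCondition (S : FieldValuationStructure K X) : Prop :=
  ∀ Φ : BlockApproximationProblem S, Nonempty Φ.Solution

end

end BlockApprox

/-!
Every `U_i` is birational to an affine space over the infinite field `L_i`, so it has an
`L_i`-rational point (`exists_section_of_birationalOver_affineSpace`). Let `a_i ∈ V(L_i)` be its
image. Since `π_i` is étale, Hensel's lemma lifts every point of `V(K)` that is close enough to
`a_i` for `v_x` to a point of `U_i(K_x)`; a point of `V(K)` which is close to each `a_i` on all of
`X_i` exists by block approximation.

The difficulty is uniformity in `x ∈ X_i`: block approximation requires the bound to be the value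
of one element `c_i` of `Kˣ`. A bound for the lifting can be given by finitely many elements `β`
of `L_iˣ` that do not depend on the valued field `(K_x, v_x)`. This is the content of the filter
`ScaledValuedExtension.smallRadius` and of
`ScaledValuedExtension.exists_point_eventually_exists_lift`, which is proved by writing `π_i`
locally as a standard étale algebra and applying Hensel's lemma to the Taylor expansion of its
defining polynomial. In general no single `d ∈ Kˣ` satisfies `v_x(d) ≥ v_x(β)` for all
`x ∈ X_i`, but for each `x` there is one, because `K_x` is algebraic over `K`
(`exists_valuation_algebraMap_le`), and the set of all `x` for which a given `d` works is clopen
and stable under `Gal(L_i)`. By compactness each block `X_i` can be subdivided into finitely many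
stable clopen pieces such that one `d` works on each piece
(`FieldValuationStructure.exists_subdivision`). The nonempty pieces form a special partition with
the same fields `L_i` (`SpecialPartition.subdivide`), to which block approximation applies.
-/

namespace BlockApprox

/-! ### Hensel's lemma for polynomials that need not be monic -/

open Polynomial IsLocalRing in
/-- Hensel's lemma at the origin for a polynomial that need not be monic. The substitution
`s = h(0) / y` turns the equation into a monic one for the unit `y`. -/
theorem exists_isRoot_mem_maximalIdeal {R : Type*} [CommRing R] [HenselianLocalRing R] (h : R[X])
    (h0 : h.coeff 0 ∈ maximalIdeal R) (h1 : IsUnit (h.coeff 1)) :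
    ∃ s ∈ maximalIdeal R, h.IsRoot s := by
  obtain ⟨m, hm⟩ : ∃ m, h.natDegree = m + 1 := by
    refine Nat.exists_eq_succ_of_ne_zero fun h' ↦ ?_
    rw [coeff_eq_zero_of_natDegree_lt (by lia)] at h1
    exact not_isUnit_zero h1
  set a := h.coeff 0
  set u := h.coeff 1
  let Q : R[X] := ∑ k ∈ Finset.range m, C (h.coeff (k + 2) * a ^ k) * X ^ (m - 1 - k)
  let M : R[X] := X ^ m * (X + C u) + C a * Q
  have hQ : Q.degree ≤ m := by
    refine (degree_sum_le _ _).trans (Finset.sup_le fun k _ ↦ ?_)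
    exact (degree_C_mul_X_pow_le _ _).trans (by exact_mod_cast (by lia))
  have hM : M.Monic := by
    have hmon : (X ^ m * (X + C u)).Monic := (monic_X_pow m).mul (monic_X_add_C u)
    refine hmon.add_of_left ?_
    have : (X ^ m * (X + C u)).degree = ((m + 1 : ℕ) : WithBot ℕ) := by
      rw [(monic_X_add_C u).degree_mul, degree_X_pow, degree_X_add_C]
      rfl
    rw [this]
    calc (C a * Q).degree ≤ Q.degree := by
          refine (degree_mul_le _ _).trans ?_
          calc _ ≤ 0 + Q.degree := by gcongr; exact degree_C_le
            _ = _ := zero_add _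
      _ ≤ m := hQ
      _ < ((m + 1 : ℕ) : WithBot ℕ) := by exact_mod_cast Nat.lt_succ_self m
  have hroot : M.eval (-u) ∈ maximalIdeal R := by
    simpa [M] using Ideal.mul_mem_right _ _ h0
  have hder : IsUnit (M.derivative.eval (-u)) := by
    have : M.derivative.eval (-u) = (-u) ^ m + a * Q.derivative.eval (-u) := by
      simp [M]
    rw [this]
    by_contra hcon
    have h2 := (maximalIdeal R).sub_mem ((mem_maximalIdeal _).2 hcon)
      (Ideal.mul_mem_right (Q.derivative.eval (-u)) _ h0)
    rw [add_sub_cancel_right] at h2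
    exact h2 (h1.neg.pow m)
  obtain ⟨y, hy, hyu⟩ := HenselianLocalRing.is_henselian M hM (-u) hroot hder
  have hyunit : IsUnit y := by
    by_contra hcon
    have h2 := (maximalIdeal R).sub_mem ((mem_maximalIdeal _).2 hcon) hyu
    rw [sub_sub_cancel] at h2
    exact h2 h1.neg
  obtain ⟨w, rfl⟩ := hyunit
  refine ⟨a * (w⁻¹ : Rˣ), Ideal.mul_mem_right _ _ h0, ?_⟩
  have key : h.eval (a * (w⁻¹ : Rˣ)) * (w : R) ^ (m + 1) = a * M.eval (w : R) := by
    have hterm : ∀ k ∈ Finset.range (m + 2),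
        h.coeff k * (a * (w⁻¹ : Rˣ)) ^ k * (w : R) ^ (m + 1) =
          h.coeff k * a ^ k * (w : R) ^ (m + 1 - k) := by
      intro k hk
      have hk' : m + 1 = k + (m + 1 - k) := by have := Finset.mem_range.1 hk; lia
      have hw : ((w⁻¹ : Rˣ) : R) ^ k * (w : R) ^ k = 1 := by simp [← mul_pow]
      conv_lhs => rw [hk', pow_add]
      linear_combination (h.coeff k * a ^ k * (w : R) ^ (m + 1 - k)) * hw
    rw [eval_eq_sum_range, hm, Finset.sum_mul, Finset.sum_congr rfl hterm,
      Finset.sum_range_succ', Finset.sum_range_succ']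
    simp only [M, Q, eval_add, eval_mul, eval_pow, eval_X, eval_C, eval_finsetSum, Finset.mul_sum,
      mul_add]
    have hs : ∀ k ∈ Finset.range m, h.coeff (k + 1 + 1) * a ^ (k + 1 + 1) *
        (w : R) ^ (m + 1 - (k + 1 + 1)) =
          a * (a * (h.coeff (k + 2) * a ^ k * (w : R) ^ (m - 1 - k))) := by
      intro k hk
      rw [show m + 1 - (k + 1 + 1) = m - 1 - k by lia]
      ring
    rw [Finset.sum_congr rfl hs]
    simp only [zero_add, pow_one, pow_zero, Nat.sub_zero, Nat.add_sub_cancel]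
    ring
  rw [hy.eq_zero, mul_zero] at key
  exact (w.isUnit.pow (m + 1)).mul_left_eq_zero.1 key


/-! ### Uniform estimates over all valued extensions of a field -/

/-- A field `F` containing the field `L`, with a valuation (given by its valuation ring) and a
nonzero element `scale` of `F`, which serves as the radius of a neighbourhood. -/
structure ScaledValuedExtension (L : Type u) [Field L] where
  /-- The extension field `F`. -/
  carrier : Type u
  [field : Field carrier]
  /-- The embedding `L → F`. -/
  emb : L →+* carrier
  /-- The valuation ring. -/
  ring : ValuationSubring carrier
  /-- The radius. -/
  scale : carrier
  scale_ne_zero : scale ≠ 0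

attribute [instance] ScaledValuedExtension.field

namespace ScaledValuedExtension

variable {L : Type u} [Field L]

/-- The valuation of a valued extension, written multiplicatively. -/
noncomputable abbrev val (E : ScaledValuedExtension L) : Valuation E.carrier E.ring.ValueGroup :=
  E.ring.valuation

variable (L) in
/-- The filter of valued extensions of `L` whose radius is small: a property holds eventually if
there are finitely many `β ∈ Lˣ` such that it holds as soon as the radius is at most each `|β|`.
The finite set of bounds does not depend on the extension, so this expresses uniformity over all
valued extensions of `L`. -/
def smallRadius : Filter (ScaledValuedExtension L) :=
  ⨅ β : Lˣ, Filter.principal {E | E.val E.scale ≤ E.val (E.emb β)}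

theorem eventually_scale_le (β : L) (hβ : β ≠ 0) :
    ∀ᶠ E in smallRadius L, E.val E.scale ≤ E.val (E.emb β) :=
  Filter.mem_iInf_of_mem (Units.mk0 β hβ) (Filter.mem_principal_self _)

theorem eventually_scale_le_one : ∀ᶠ E in smallRadius L, E.val E.scale ≤ 1 :=
  (eventually_scale_le (1 : L) one_ne_zero).mono fun E hE ↦ by simpa using hE

theorem eventually_smallRadius_iff {P : ScaledValuedExtension L → Prop} :
    (∀ᶠ E in smallRadius L, P E) ↔
      ∃ D : Finset Lˣ, ∀ E : ScaledValuedExtension L,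
        (∀ β ∈ D, E.val E.scale ≤ E.val (E.emb β)) → P E := by
  rw [smallRadius, Filter.eventually_iff, (Filter.hasBasis_iInf_principal_finite _).mem_iff]
  constructor
  · rintro ⟨t, ht, h⟩
    refine ⟨ht.toFinset, fun E hE ↦ h ?_⟩
    simpa using hE
  · rintro ⟨D, h⟩
    exact ⟨D, D.finite_toSet, fun E hE ↦ h E (by simpa using hE)⟩

theorem val_scale_pos (E : ScaledValuedExtension L) : 0 < E.val E.scale :=
  zero_lt_iff.2 ((Valuation.ne_zero_iff _).2 E.scale_ne_zero)

theorem eventually_mul_scale_le (c γ : L) (hγ : γ ≠ 0) :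
    ∀ᶠ E in smallRadius L, E.val (E.emb c) * E.val E.scale ≤ E.val (E.emb γ) := by
  by_cases hc : c = 0
  · simp [hc]
  filter_upwards [eventually_scale_le (γ / c) (div_ne_zero hγ hc)] with E hE
  rw [map_div₀, map_div₀, le_div_iff₀ (zero_lt_iff.2 (by simpa using hc))] at hE
  rwa [mul_comm]

/-- A polynomial over `L` is Lipschitz near a point of `Lⁿ`, uniformly in all valued extensions
of `L`: its Lipschitz constant is at most the inverse of every small radius. -/
theorem eventually_eval_sub_lt {σ : Type*} (a : σ → L) (p : MvPolynomial σ L) :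
    ∀ γ : L, γ ≠ 0 → ∀ᶠ E in smallRadius L, ∀ e : E.carrier, e ≠ 0 → E.val e ≤ 1 →
      ∀ y : σ → E.carrier, (∀ j, E.val (y j - E.emb (a j)) < E.val e) →
        E.val (MvPolynomial.eval₂ E.emb y p - E.emb (MvPolynomial.eval a p)) * E.val E.scale <
          E.val (E.emb γ) * E.val e := by
  have pos : ∀ (E : ScaledValuedExtension L) (γ : L), γ ≠ 0 → ∀ e : E.carrier, e ≠ 0 →
      0 < E.val (E.emb γ) * E.val e := fun E γ hγ e he ↦
    mul_pos (zero_lt_iff.2 (by simpa using hγ)) (zero_lt_iff.2 (by simpa using he))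
  induction p using MvPolynomial.induction_on with
  | C c =>
    intro γ hγ
    refine .of_forall fun E e he _ y _ ↦ ?_
    simpa using pos E γ hγ e he
  | add p q hp hq =>
    intro γ hγ
    filter_upwards [hp γ hγ, hq γ hγ] with E hp hq e he he1 y hy
    have hp := hp e he he1 y hy
    have hq := hq e he he1 y hy
    rw [← map_mul] at hp hq ⊢
    rw [MvPolynomial.eval₂_add, map_add, map_add, add_sub_add_comm, add_mul]
    exact Valuation.map_add_lt _ hp hq
  | mul_X p j hp =>
    intro γ hγ
    have haj : ∀ᶠ E in smallRadius L, ∀ e : E.carrier, e ≠ 0 → E.val e ≤ 1 →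
        ∀ y : σ → E.carrier, (∀ j, E.val (y j - E.emb (a j)) < E.val e) →
        E.val ((MvPolynomial.eval₂ E.emb y p - E.emb (MvPolynomial.eval a p)) * E.scale *
          E.emb (a j)) < E.val (E.emb γ) * E.val e := by
      by_cases ha : a j = 0
      · refine .of_forall fun E e he _ y _ ↦ ?_
        simpa [ha] using pos E γ hγ e he
      filter_upwards [hp (γ / a j) (div_ne_zero hγ ha)] with E hp e he he1 y hy
      have hp := hp e he he1 y hy
      have ha' : 0 < E.val (E.emb (a j)) := zero_lt_iff.2 (by simpa using ha)
      rw [map_mul, map_mul]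
      calc _ < E.val (E.emb (γ / a j)) * E.val e * E.val (E.emb (a j)) :=
            mul_lt_mul_of_pos_right hp ha'
        _ = _ := by
            rw [map_div₀, map_div₀]
            field_simp
    filter_upwards [hp γ hγ, haj, eventually_mul_scale_le (MvPolynomial.eval a p) γ hγ]
      with E hp haj hpa e he he1 y hy
    have hp := hp e he he1 y hy
    have hyj := hy j
    have hsplit : (MvPolynomial.eval₂ E.emb y (p * MvPolynomial.X j) -
        E.emb (MvPolynomial.eval a (p * MvPolynomial.X j))) * E.scale =
        (MvPolynomial.eval₂ E.emb y p - E.emb (MvPolynomial.eval a p)) * E.scale *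
          (y j - E.emb (a j)) +
        ((MvPolynomial.eval₂ E.emb y p - E.emb (MvPolynomial.eval a p)) * E.scale *
          E.emb (a j) +
        E.emb (MvPolynomial.eval a p) * E.scale * (y j - E.emb (a j))) := by
      simp only [MvPolynomial.eval₂_mul, MvPolynomial.eval₂_X, map_mul, MvPolynomial.eval_X]
      ring
    rw [← map_mul, hsplit]
    refine Valuation.map_add_lt _ ?_ (Valuation.map_add_lt _ (haj e he he1 y hy) ?_)
    · rw [map_mul, map_mul]
      rw [map_mul] at *
      exact (mul_le_of_le_one_right' (hyj.le.trans he1)).trans_lt hp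
    · rw [map_mul, map_mul]
      calc _ ≤ E.val (E.emb γ) * E.val (y j - E.emb (a j)) := by gcongr
        _ < _ := mul_lt_mul_of_pos_left hyj (zero_lt_iff.2 (by simpa using hγ))

/-- A point `y` of `Fⁿ` is close to a point `a` of `Lⁿ` if each coordinate of `y - a` is smaller
than the fourth power of the radius `d`. A polynomial over `L` then varies by less than `|d|³`,
which is what Newton's method needs for an equation in `s` obtained by `t = t₀ + d² s`. -/
def IsClose {σ : Type*} (E : ScaledValuedExtension L) (a : σ → L) (y : σ → E.carrier) : Prop :=
  ∀ j, E.val (y j - E.emb (a j)) < E.val (E.scale ^ 4)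

/-- The coefficients of a polynomial depending on parameters are bounded by the inverse of the
radius, and vary by less than its cube, near a point of `Lⁿ`. -/
theorem eventually_coeff_close {σ : Type*} (a : σ → L) (q : Polynomial (MvPolynomial σ L)) :
    ∀ᶠ E in smallRadius L, ∀ y : σ → E.carrier, E.IsClose a y → ∀ k,
      E.val (MvPolynomial.eval₂ E.emb y (q.coeff k) - E.emb (MvPolynomial.eval a (q.coeff k))) <
          E.val E.scale ^ 3 ∧
        E.val (MvPolynomial.eval₂ E.emb y (q.coeff k)) * E.val E.scale ≤ 1 := by
  have h1 : ∀ᶠ E in smallRadius L, ∀ k ∈ q.support, ∀ e : E.carrier, e ≠ 0 → E.val e ≤ 1 →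
      ∀ y : σ → E.carrier, (∀ j, E.val (y j - E.emb (a j)) < E.val e) →
        E.val (MvPolynomial.eval₂ E.emb y (q.coeff k) -
          E.emb (MvPolynomial.eval a (q.coeff k))) * E.val E.scale <
          E.val (E.emb 1) * E.val e :=
    (Filter.eventually_all_finset _).2 fun k _ ↦ eventually_eval_sub_lt a _ 1 one_ne_zero
  have h2 : ∀ᶠ E in smallRadius L, ∀ k ∈ q.support,
      E.val (E.emb (MvPolynomial.eval a (q.coeff k))) * E.val E.scale ≤ E.val (E.emb 1) :=
    (Filter.eventually_all_finset _).2 fun k _ ↦ eventually_mul_scale_le _ 1 one_ne_zero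
  filter_upwards [h1, h2, eventually_scale_le_one] with E h1 h2 hd y hy k
  have hd0 := E.val_scale_pos
  by_cases hk : k ∈ q.support
  swap
  · rw [Polynomial.notMem_support_iff.1 hk]
    simpa using pow_pos hd0 3
  have h3 := h1 k hk (E.scale ^ 4) (pow_ne_zero 4 E.scale_ne_zero)
    (by rw [map_pow]; exact pow_le_one' hd 4) y hy
  have h2 := h2 k hk
  rw [map_one, map_one] at h2
  rw [map_one, map_one, one_mul, map_pow, pow_succ] at h3
  have h4 := lt_of_mul_lt_mul_right h3 hd0.le
  refine ⟨h4, ?_⟩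
  rw [← map_mul] at h2 ⊢
  rw [← sub_add_cancel (MvPolynomial.eval₂ E.emb y (q.coeff k))
    (E.emb (MvPolynomial.eval a (q.coeff k))), add_mul]
  refine Valuation.map_add_le _ ?_ h2
  rw [map_mul]
  exact mul_le_one' (h4.le.trans (pow_le_one' hd 3)) hd

/-- A simple root `t₀` of a polynomial over `L` depending on parameters deforms along with the
parameters in Henselian extensions, and an inequation satisfied by `t₀` is preserved. -/
theorem eventually_exists_root {σ : Type*} (a : σ → L) (t₀ : L)
    (f g : Polynomial (MvPolynomial σ L)) (hf : f.eval₂ (MvPolynomial.eval a) t₀ = 0)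
    (hf' : f.derivative.eval₂ (MvPolynomial.eval a) t₀ ≠ 0)
    (hg : g.eval₂ (MvPolynomial.eval a) t₀ ≠ 0) :
    ∀ᶠ E in smallRadius L, HenselianLocalRing E.ring → ∀ y : σ → E.carrier, E.IsClose a y →
      ∃ t : E.carrier, f.eval₂ (MvPolynomial.eval₂Hom E.emb y) t = 0 ∧
        g.eval₂ (MvPolynomial.eval₂Hom E.emb y) t ≠ 0 := by
  set F := Polynomial.taylor (MvPolynomial.C t₀) f with hF
  set G := Polynomial.taylor (MvPolynomial.C t₀) g with hG
  have evalC : ∀ q : Polynomial (MvPolynomial σ L), MvPolynomial.eval a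
      (q.eval (MvPolynomial.C t₀)) = q.eval₂ (MvPolynomial.eval a) t₀ := fun q ↦ by
    rw [← Polynomial.eval₂_hom, MvPolynomial.eval_C]
  have F0 : MvPolynomial.eval a (F.coeff 0) = 0 := by
    rw [hF, Polynomial.taylor_coeff_zero, evalC, hf]
  have F1 : MvPolynomial.eval a (F.coeff 1) ≠ 0 := by
    rwa [hF, Polynomial.taylor_coeff_one, evalC]
  have G0 : MvPolynomial.eval a (G.coeff 0) ≠ 0 := by
    rwa [hG, Polynomial.taylor_coeff_zero, evalC]
  filter_upwards [eventually_coeff_close a F, eventually_coeff_close a G, eventually_scale_le_one,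
    eventually_scale_le _ F1, eventually_scale_le _ G0] with E hFE hGE hd hdF hdG hH y hy
  have hd0 := E.val_scale_pos
  have hFE := hFE y hy
  have hGE := hGE y hy
  set d := E.scale
  have hdne : d ≠ 0 := E.scale_ne_zero
  set ev : MvPolynomial σ L →+* E.carrier := MvPolynomial.eval₂Hom E.emb y
  set c := E.emb (MvPolynomial.eval a (F.coeff 1))
  have hc : c ≠ 0 := by simpa [c] using F1
  have hcpos : 0 < E.val c := zero_lt_iff.2 (by simpa using hc)
  -- the expansion at `t₀` in the variable `s` with `t = t₀ + d² s`
  let rescale (q : Polynomial (MvPolynomial σ L)) : Polynomial E.carrier :=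
    (q.map ev).comp (Polynomial.C (d ^ 2) * Polynomial.X)
  have hcoeff : ∀ q k, (rescale q).coeff k =
      MvPolynomial.eval₂ E.emb y (q.coeff k) * (d ^ 2) ^ k := fun q k ↦ by
    rw [Polynomial.comp_C_mul_X_coeff, Polynomial.coeff_map]
    rfl
  have heval : ∀ q s, (rescale (Polynomial.taylor (MvPolynomial.C t₀) q)).eval s =
      q.eval₂ ev (E.emb t₀ + d ^ 2 * s) := fun q s ↦ by
    simp only [rescale, Polynomial.taylor_apply, Polynomial.eval_comp, Polynomial.map_comp,
      Polynomial.map_add, Polynomial.map_X, Polynomial.map_C, Polynomial.eval_add,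
      Polynomial.eval_mul, Polynomial.eval_C, Polynomial.eval_X, Polynomial.eval_map]
    congr 1
    simp [ev]
    ring
  have hpow : ∀ n, E.val d * E.val d ^ n ≤ E.val d := fun n ↦
    mul_le_of_le_one_right' (pow_le_one' hd n)
  -- `h` is integral with unit linear coefficient and constant term in the maximal ideal, since
  -- the coefficient of `s ^ k` in the expansion of `f` is divisible by `d ^ (2 * k)`
  let h : Polynomial E.carrier := Polynomial.C (c * d ^ 2)⁻¹ * rescale F
  have hcd : 0 < E.val c * E.val d ^ 2 := mul_pos hcpos (pow_pos hd0 2)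
  have hval : ∀ k, E.val (h.coeff k) =
      E.val (MvPolynomial.eval₂ E.emb y (F.coeff k)) * E.val d ^ (2 * k) /
        (E.val c * E.val d ^ 2) := fun k ↦ by
    rw [Polynomial.coeff_C_mul, hcoeff, map_mul, map_inv₀, map_mul, map_mul, map_pow, map_pow,
      map_pow, pow_mul, div_eq_inv_mul]
  have hk0 : E.val (h.coeff 0) < 1 := by
    have := (hFE 0).1
    rw [F0, map_zero, sub_zero] at this
    rw [hval, div_lt_one₀ hcd, mul_zero, pow_zero, mul_one]
    refine this.trans_le ?_
    rw [pow_succ']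
    gcongr
  have hk1 : E.val (h.coeff 1) = 1 := by
    have h1 : E.val (MvPolynomial.eval₂ E.emb y (F.coeff 1)) = E.val c := by
      have : E.val (MvPolynomial.eval₂ E.emb y (F.coeff 1) - c) < E.val c := by
        refine (hFE 1).1.trans_le ?_
        rw [pow_succ']
        exact (hpow 2).trans hdF
      simpa using Valuation.map_add_eq_of_lt_right _ this
    rw [hval, h1, mul_one, div_self hcd.ne']
  have hk2 : ∀ k, E.val (h.coeff (k + 2)) ≤ 1 := fun k ↦ by
    rw [hval, div_le_one₀ hcd]
    have := (hFE (k + 2)).2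
    calc _ = E.val (MvPolynomial.eval₂ E.emb y (F.coeff (k + 2))) * E.val d *
          (E.val d * E.val d ^ (2 * k)) * E.val d ^ 2 := by
            rw [show 2 * (k + 2) = 1 + 1 + 2 * k + 2 by ring]
            simp only [pow_add, pow_one, mul_assoc]
      _ ≤ 1 * E.val d * E.val d ^ 2 := by gcongr; exact hpow _
      _ ≤ _ := by rw [one_mul]; gcongr
  have hmem : (↑h.coeffs : Set E.carrier) ⊆ E.ring.toSubring := by
    intro z hz
    obtain ⟨k, -, rfl⟩ := Polynomial.mem_coeffs_iff.1 hz
    refine (E.ring.valuation_le_one_iff _).1 ?_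
    rcases k with _ | _ | k
    exacts [hk0.le, hk1.le, hk2 k]
  let hO : Polynomial E.ring := h.toSubring E.ring.toSubring hmem
  have hOc : ∀ k, ((hO.coeff k : E.ring) : E.carrier) = h.coeff k :=
    fun k ↦ Polynomial.coeff_toSubring _ _ hmem
  obtain ⟨s, hs, hroot⟩ := exists_isRoot_mem_maximalIdeal hO
    ((ValuationSubring.valuation_lt_one_iff _ _).2 (by rw [hOc]; exact hk0))
    ((ValuationSubring.valuation_eq_one_iff _ _).2 (by rw [hOc]; exact hk1))
  have hs1 : E.val (s : E.carrier) < 1 := (ValuationSubring.valuation_lt_one_iff _ _).1 hs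
  have hh : h.eval (s : E.carrier) = 0 := by
    have hmap : hO.map E.ring.subtype = h := Polynomial.ext fun k ↦ by
      rw [Polynomial.coeff_map]; exact hOc k
    have := congrArg E.ring.subtype hroot
    rw [← Polynomial.eval_map_apply, hmap, map_zero] at this
    exact this
  refine ⟨E.emb t₀ + d ^ 2 * s, ?_, ?_⟩
  · rw [← heval]
    simp only [h, Polynomial.eval_mul, Polynomial.eval_C] at hh
    exact (mul_eq_zero.1 hh).resolve_left (inv_ne_zero (mul_ne_zero hc (pow_ne_zero 2 hdne)))
  · rw [← heval, ← hG]
    set g₀ := E.emb (MvPolynomial.eval a (G.coeff 0))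
    -- all terms but the constant one are smaller than `g(a, t₀)`
    have hdiff : E.val ((rescale G).eval (s : E.carrier) - g₀) < E.val g₀ := by
      rw [← Polynomial.divX_mul_X_add (rescale G), Polynomial.eval_add, Polynomial.eval_mul,
        Polynomial.eval_X, Polynomial.eval_C, add_sub_assoc]
      refine Valuation.map_add_lt _ ?_ ?_
      · have hle : E.val ((rescale G).divX.eval (s : E.carrier)) ≤ E.val d := by
          rw [Polynomial.eval_eq_sum_range]
          refine Valuation.map_sum_le _ fun k _ ↦ ?_
          rw [Polynomial.coeff_divX, hcoeff, map_mul, map_mul, map_pow, map_pow, map_pow]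
          have := (hGE (k + 1)).2
          calc _ = E.val (MvPolynomial.eval₂ E.emb y (G.coeff (k + 1))) * E.val d *
                (E.val d * E.val d ^ (2 * k)) * E.val (s : E.carrier) ^ k := by
                  rw [← pow_mul, show 2 * (k + 1) = 1 + 1 + 2 * k by ring]
                  simp only [pow_add, pow_one, mul_assoc]
            _ ≤ 1 * E.val d * 1 := by gcongr; exacts [hpow _, pow_le_one' hs1.le _]
            _ = _ := by rw [one_mul, mul_one]
        rw [map_mul]
        calc _ ≤ E.val d * E.val (s : E.carrier) := by gcongr
          _ < E.val d * 1 := mul_lt_mul_of_pos_left hs1 hd0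
          _ ≤ _ := by rwa [mul_one]
      · rw [hcoeff, pow_zero, mul_one]
        refine (hGE 0).1.trans_le ?_
        rw [pow_succ']
        exact (hpow 2).trans hdG
    intro h0
    rw [h0, zero_sub, Valuation.map_neg] at hdiff
    exact hdiff.false

/-! ### Lifting points along étale algebras -/

/-- Points of a ring near an `L`-rational point lift along a standard étale algebra on which that
rational point has a lift. -/
theorem eventually_exists_lift_of_isStandardEtale {σ : Type*} {A B : Type*} [CommRing A]
    [CommRing B] [Algebra A B] [Algebra.IsStandardEtale A B] (φ : MvPolynomial σ L →+* A)
    (hφ : Function.Surjective φ) (θ : B →+* L) (a : σ → L)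
    (ha : ((θ.comp (algebraMap A B)).comp φ) = MvPolynomial.eval a) :
    ∀ᶠ E in smallRadius L, HenselianLocalRing E.ring →
      ∀ ψ : A →+* E.carrier, ψ.comp (φ.comp MvPolynomial.C) = E.emb →
        E.IsClose a (fun j ↦ ψ (φ (.X j))) → ∃ χ : B →+* E.carrier, χ.comp (algebraMap A B) = ψ := by
  obtain ⟨P⟩ := Algebra.IsStandardEtale.nonempty_standardEtalePresentation (R := A) (S := B)
  obtain ⟨f, hf⟩ := Polynomial.map_surjective φ hφ P.f
  obtain ⟨g, hg⟩ := Polynomial.map_surjective φ hφ P.g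
  have heval : ∀ q : Polynomial (MvPolynomial σ L),
      q.eval₂ (MvPolynomial.eval a) (θ P.x) = θ (Polynomial.aeval P.x (q.map φ)) := fun q ↦ by
    rw [← ha, Polynomial.aeval_def, Polynomial.hom_eval₂, Polynomial.eval₂_map]
  have h1 : f.eval₂ (MvPolynomial.eval a) (θ P.x) = 0 := by
    rw [heval, hf, P.hasMap.1, map_zero]
  have h2 : f.derivative.eval₂ (MvPolynomial.eval a) (θ P.x) ≠ 0 := by
    rw [heval, ← Polynomial.derivative_map, hf]
    exact (P.hasMap.isUnit_derivative_f.map θ).ne_zero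
  have h3 : g.eval₂ (MvPolynomial.eval a) (θ P.x) ≠ 0 := by
    rw [heval, hg]
    exact (P.hasMap.2.map θ).ne_zero
  filter_upwards [eventually_exists_root a (θ P.x) f g h1 h2 h3] with E hE hH ψ hψ hclose
  obtain ⟨t, ht, ht'⟩ := hE hH _ hclose
  have hev : MvPolynomial.eval₂Hom E.emb (fun j ↦ ψ (φ (.X j))) = ψ.comp φ := by
    refine MvPolynomial.ringHom_ext (fun r ↦ ?_) fun j ↦ ?_
    · simp [← hψ]
    · simp
  rw [hev, ← Polynomial.eval₂_map, hf] at ht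
  rw [hev, ← Polynomial.eval₂_map, hg] at ht'
  algebraize [ψ]
  have hmap : P.HasMap t := ⟨ht, isUnit_iff_ne_zero.2 ht'⟩
  exact ⟨((P.lift t hmap).comp P.equivRing.toAlgHom).toRingHom,
    ((P.lift t hmap).comp P.equivRing.toAlgHom).comp_algebraMap⟩

/-- Points of a ring near an `L`-rational point lift along an étale algebra on which that rational
point has a lift. -/
theorem eventually_exists_lift_of_etale {σ : Type*} {A B : Type*} [CommRing A]
    [CommRing B] [Algebra A B] [Algebra.Etale A B] (φ : MvPolynomial σ L →+* A)
    (hφ : Function.Surjective φ) (θ : B →+* L) (a : σ → L)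
    (ha : ((θ.comp (algebraMap A B)).comp φ) = MvPolynomial.eval a) :
    ∀ᶠ E in smallRadius L, HenselianLocalRing E.ring →
      ∀ ψ : A →+* E.carrier, ψ.comp (φ.comp MvPolynomial.C) = E.emb →
        E.IsClose a (fun j ↦ ψ (φ (.X j))) → ∃ χ : B →+* E.carrier, χ.comp (algebraMap A B) = ψ := by
  have := RingHom.ker_isPrime θ
  obtain ⟨b, hb, hstd⟩ := Algebra.IsEtaleAt.exists_isStandardEtale (R := A) (RingHom.ker θ)
  have hunit : IsUnit (θ b) := isUnit_iff_ne_zero.2 hb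
  let θ' : Localization.Away b →+* L := IsLocalization.Away.lift b hunit
  have hθ' : θ'.comp (algebraMap A (Localization.Away b)) = θ.comp (algebraMap A B) := by
    rw [IsScalarTower.algebraMap_eq A B (Localization.Away b), ← RingHom.comp_assoc,
      IsLocalization.Away.lift_comp]
  filter_upwards [eventually_exists_lift_of_isStandardEtale φ hφ θ' a (by rw [hθ', ha])]
    with E hE hH ψ hψ hclose
  obtain ⟨χ, hχ⟩ := hE hH ψ hψ hclose
  exact ⟨χ.comp (algebraMap B _), by
    rw [RingHom.comp_assoc, ← IsScalarTower.algebraMap_eq, hχ]⟩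

end ScaledValuedExtension

section

open AlgebraicGeometry CategoryTheory CategoryTheory.Limits
open scoped TensorProduct

/-! ### Rational points and lifting along étale morphisms -/

/-- Over an infinite field, every scheme birational to an affine space has a rational point. -/
theorem exists_section_of_birationalOver_affineSpace {L : Type u} [Field L] [Infinite L]
    {n : Type u} {U : Scheme.{u}} (q : U ⟶ Spec (.of L))
    (h : Scheme.BirationalOver q (𝔸(n; Spec (.of L)) ↘ Spec (.of L))) :
    ∃ b : Spec (.of L) ⟶ U, b ≫ q = 𝟙 _ := by
  obtain ⟨f, hf⟩ := h
  let e := AffineSpace.SpecIso n (.of L)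
  let T : (Spec (.of (MvPolynomial n L))).Opens := e.inv ⁻¹ᵁ f.target
  have hne : Nonempty (𝔸(n; Spec (.of L))) :=
    ⟨e.inv (show PrimeSpectrum (MvPolynomial n L) from ⊥)⟩
  obtain ⟨z, hz⟩ := f.dense_target.nonempty
  have hzT : e.hom z ∈ T := by
    change e.inv (e.hom z) ∈ f.target
    simpa using hz
  obtain ⟨_, ⟨p, rfl⟩, hzp, hpT⟩ :=
    PrimeSpectrum.isTopologicalBasis_basic_opens.exists_subset_of_mem_open hzT T.isOpen
  have hp : p ≠ 0 := by
    rintro rfl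
    simp at hzp
    exact hzp
  -- a nonzero polynomial over an infinite field has a nonzero value
  obtain ⟨a, ha⟩ : ∃ a : n → L, MvPolynomial.eval a p ≠ 0 := by
    by_contra! hcon
    exact hp (MvPolynomial.funext fun x ↦ by simpa using hcon x)
  let t : Spec (.of L) ⟶ 𝔸(n; Spec (.of L)) :=
    Spec.map (CommRingCat.ofHom (MvPolynomial.eval a)) ≫ e.inv
  have ht : t ≫ (𝔸(n; Spec (.of L)) ↘ Spec (.of L)) = 𝟙 _ := by
    rw [Category.assoc, AffineSpace.SpecIso_inv_over, ← Spec.map_comp, ← CommRingCat.ofHom_comp]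
    have : (MvPolynomial.eval a).comp (MvPolynomial.C (σ := n)) = RingHom.id L := by ext; simp
    rw [this]
    exact Spec.map_id _
  have hrange : Set.range t ⊆ Set.range f.target.ι := by
    rintro _ ⟨w, rfl⟩
    rw [Scheme.Opens.range_ι]
    refine hpT (a := Spec.map (CommRingCat.ofHom (MvPolynomial.eval a)) w) ?_
    intro hmem
    have : MvPolynomial.eval a p ∈ (show PrimeSpectrum L from w).asIdeal := hmem
    exact (show PrimeSpectrum L from w).isPrime.ne_top
      (Ideal.eq_top_of_isUnit_mem _ this (isUnit_iff_ne_zero.2 ha))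
  refine ⟨IsOpenImmersion.lift f.target.ι t hrange ≫ f.iso.inv ≫ f.source.ι, ?_⟩
  simp only [Category.assoc]
  rw [← hf, Iso.inv_hom_id_assoc, IsOpenImmersion.lift_fac_assoc, ht]

/-- Points near the image of a rational point lift along an étale morphism to an affine scheme. -/
theorem ScaledValuedExtension.eventually_exists_lift_of_etale_morphism {L : Type u} [Field L]
    {σ : Type*} {A : Type u} [CommRing A] (φ : MvPolynomial σ L →+* A)
    (hφ : Function.Surjective φ) {U : Scheme.{u}} (f : U ⟶ Spec (.of A)) [Etale f]
    (b : Spec (.of L) ⟶ U) (θ : A →+* L) (hb : b ≫ f = Spec.map (CommRingCat.ofHom θ))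
    (a : σ → L) (ha : θ.comp φ = MvPolynomial.eval a) :
    ∀ᶠ E in smallRadius L, HenselianLocalRing E.ring →
      ∀ ψ : A →+* E.carrier, ψ.comp (φ.comp MvPolynomial.C) = E.emb →
        E.IsClose a (fun j ↦ ψ (φ (.X j))) →
        ∃ b' : Spec (.of E.carrier) ⟶ U, b' ≫ f = Spec.map (CommRingCat.ofHom ψ) := by
  let z : Spec (.of L) := (show PrimeSpectrum L from ⊥)
  obtain ⟨_, ⟨V, hV, rfl⟩, hzV, -⟩ := U.isBasis_affineOpens.exists_subset_of_mem_open
    (Set.mem_univ (b z)) isOpen_univ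
  have hrange : Set.range b ⊆ Set.range (IsAffineOpen.fromSpec hV) := by
    rintro _ ⟨w, rfl⟩
    rw [IsAffineOpen.range_fromSpec hV]
    have : w = z := Subsingleton.elim (α := PrimeSpectrum L) w z
    rwa [this]
  let j := IsAffineOpen.fromSpec hV
  have : IsOpenImmersion j := hV.isOpenImmersion_fromSpec
  obtain ⟨θ', hθ'⟩ := Spec.map_surjective (IsOpenImmersion.lift j b hrange)
  obtain ⟨ϕ, hϕ⟩ := Spec.map_surjective (j ≫ f)
  have het : ϕ.hom.Etale := by
    rw [← HasRingHomProperty.Spec_iff (P := @Etale), hϕ]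
    infer_instance
  algebraize [ϕ.hom]
  have hcomp : θ'.hom.comp ϕ.hom = θ := by
    have : ϕ ≫ θ' = CommRingCat.ofHom θ := by
      apply Spec.map_injective
      rw [Spec.map_comp, hθ', hϕ, IsOpenImmersion.lift_fac_assoc, hb]
    rw [← CommRingCat.hom_comp, this, CommRingCat.hom_ofHom]
  filter_upwards [eventually_exists_lift_of_etale (B := Γ(U, V)) φ hφ θ'.hom a
    (by rw [RingHom.algebraMap_toAlgebra, hcomp, ha])] with E hE hH ψ hψ hclose
  obtain ⟨χ, hχ⟩ := hE hH ψ hψ hclose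
  refine ⟨Spec.map (CommRingCat.ofHom χ) ≫ j, ?_⟩
  rw [Category.assoc, ← hϕ, ← Spec.map_comp]
  congr 1
  ext1
  exact hχ

/-! ### Points of affine varieties and their base change -/

/-- An affine scheme of finite type over a field is the zero scheme of an ideal of polynomials. -/
theorem exists_iso_spec_mvPolynomial_quotient {K : Type u} [Field K] {V : Scheme.{u}} [IsAffine V]
    (p : V ⟶ Spec (.of K)) [LocallyOfFiniteType p] :
    ∃ (n : ℕ) (I : Ideal (MvPolynomial (Fin n) K))
      (e : V ≅ Spec (.of (MvPolynomial (Fin n) K ⧸ I))),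
      e.hom ≫ Spec.map (CommRingCat.ofHom (algebraMap K (MvPolynomial (Fin n) K ⧸ I))) = p := by
  obtain ⟨κ, hκ⟩ := Spec.map_surjective (V.isoSpec.inv ≫ p)
  have hft : κ.hom.FiniteType := by
    rw [← HasRingHomProperty.Spec_iff (P := @LocallyOfFiniteType), hκ]
    infer_instance
  algebraize [κ.hom]
  obtain ⟨n, f, hf⟩ := Algebra.FiniteType.iff_quotient_mvPolynomial''.1 hft
  let g := Ideal.quotientKerAlgEquivOfSurjective hf
  refine ⟨n, RingHom.ker f, V.isoSpec ≪≫ Scheme.Spec.mapIso g.toRingEquiv.toCommRingCatIso.op, ?_⟩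
  have hg : CommRingCat.ofHom (algebraMap K (MvPolynomial (Fin n) K ⧸ RingHom.ker f)) ≫
      g.toRingEquiv.toCommRingCatIso.hom = κ := by
    ext1
    exact g.toAlgHom.comp_algebraMap
  change (V.isoSpec.hom ≫ Spec.map g.toRingEquiv.toCommRingCatIso.hom) ≫ _ = _
  rw [Category.assoc, ← Spec.map_comp, hg, hκ, Iso.hom_inv_id_assoc]

/-- The base change of an affine scheme `V` over `K`, given by a quotient of a
polynomial ring, to an
extension `L` of `K` is the spectrum of a quotient of `L[X₁, …, Xₙ]`, and its points with values in
a ring are pairs of a point of `V` and a homomorphism from `L`. -/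
theorem exists_iso_spec_pullback {K L : Type u} [Field K] [Field L]
    [Algebra K L] {n : ℕ} {A₀ : Type u} [CommRing A₀] [Algebra K A₀]
    (α : MvPolynomial (Fin n) K →ₐ[K] A₀) (hα : Function.Surjective α) {V : Scheme.{u}}
    {p : V ⟶ Spec (.of K)} (e : V ≅ Spec (.of A₀))
    (he : e.hom ≫ Spec.map (CommRingCat.ofHom (algebraMap K A₀)) = p) :
    ∃ (A : Type u) (_ : CommRing A) (φ : MvPolynomial (Fin n) L →+* A)
      (ιV : A₀ →+* A)
      (c : pullback p (Spec.map (CommRingCat.ofHom (algebraMap K L))) ≅ Spec (.of A)),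
      Function.Surjective φ ∧
      φ.comp (MvPolynomial.map (algebraMap K L)) = ιV.comp α.toRingHom ∧
      c.hom ≫ Spec.map (CommRingCat.ofHom (φ.comp MvPolynomial.C)) = pullback.snd _ _ ∧
      c.hom ≫ Spec.map (CommRingCat.ofHom ιV) = pullback.fst _ _ ≫ e.hom ∧
      ∀ (F : Type u) [CommRing F] (g : L →+* F) (h : A₀ →+* F),
        h.comp (algebraMap K _) = g.comp (algebraMap K L) →
        ∃ ψ : A →+* F, ψ.comp ιV = h ∧ ψ.comp (φ.comp MvPolynomial.C) = g := by
  let inL : L →+* A₀ ⊗[K] L :=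
    RingHomClass.toRingHom (Algebra.TensorProduct.includeRight (R := K))
  let inV : A₀ →+* A₀ ⊗[K] L :=
    Algebra.TensorProduct.includeLeftRingHom
  let φ : MvPolynomial (Fin n) L →+* A₀ ⊗[K] L :=
    MvPolynomial.eval₂Hom inL fun j ↦ inV (α (.X j))
  have hφC : φ.comp MvPolynomial.C = inL := MvPolynomial.eval₂Hom_comp_C _ _
  have hφK : φ.comp (MvPolynomial.map (algebraMap K L)) = inV.comp α.toRingHom := by
    apply MvPolynomial.ringHom_ext
    · intro r
      have hr : α (MvPolynomial.C r) = algebraMap K A₀ r := α.commutes r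
      simp only [RingHom.comp_apply, MvPolynomial.map_C, φ, MvPolynomial.eval₂Hom_C,
        AlgHom.toRingHom_eq_coe, RingHom.coe_coe, hr]
      exact (Algebra.TensorProduct.algebraMap_apply' r).symm.trans
        (Algebra.TensorProduct.algebraMap_apply r)
    · intro j
      simp [φ]
  let c₁ := pullback.map p (Spec.map (CommRingCat.ofHom (algebraMap K L)))
    (Spec.map (CommRingCat.ofHom (algebraMap K A₀)))
    (Spec.map (CommRingCat.ofHom (algebraMap K L))) e.hom (𝟙 _) (𝟙 _)
    (by rw [he, Category.comp_id]) (by simp)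
  refine ⟨A₀ ⊗[K] L, inferInstance, φ, inV,
    asIso c₁ ≪≫ pullbackSpecIso K A₀ L, ?_, hφK, ?_, ?_, ?_⟩
  · intro z
    induction z using TensorProduct.induction_on with
    | zero => exact ⟨0, map_zero _⟩
    | add z w hz hw =>
      obtain ⟨f, rfl⟩ := hz
      obtain ⟨g, rfl⟩ := hw
      exact ⟨f + g, map_add _ _ _⟩
    | tmul z l =>
      obtain ⟨f, rfl⟩ := hα z
      refine ⟨MvPolynomial.map (algebraMap K L) f * .C l, ?_⟩
      rw [map_mul, ← RingHom.comp_apply φ, ← RingHom.comp_apply φ, hφK, hφC]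
      simp [inV, inL]
  · rw [hφC, Iso.trans_hom, asIso_hom, Category.assoc]
    have := pullbackSpecIso_hom_snd K A₀ L
    refine (congrArg (c₁ ≫ ·) this).trans ?_
    exact (pullback.lift_snd _ _ _).trans (Category.comp_id _)
  · rw [Iso.trans_hom, asIso_hom, Category.assoc]
    have := pullbackSpecIso_hom_fst K A₀ L
    refine (congrArg (c₁ ≫ ·) this).trans ?_
    exact pullback.lift_fst _ _ _
  · intro F _ g h hgh
    rw [hφC]
    algebraize [g, g.comp (algebraMap K L)]
    let fV : A₀ →ₐ[K] F := { h with commutes' := RingHom.congr_fun hgh }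
    let fL : L →ₐ[K] F := IsScalarTower.toAlgHom K L F
    have hcomm : ∀ x y, Commute (fV x) (fL y) := fun _ _ ↦ .all _ _
    refine ⟨RingHomClass.toRingHom (Algebra.TensorProduct.lift fV fL hcomm), ?_, ?_⟩
    · refine RingHom.ext fun z ↦ ?_
      exact (Algebra.TensorProduct.lift_tmul fV fL hcomm z 1).trans (by rw [map_one, mul_one]; rfl)
    · refine RingHom.ext fun z ↦ ?_
      exact (Algebra.TensorProduct.lift_tmul fV fL hcomm 1 z).trans (by rw [map_one, one_mul]; rfl)

/-- Let `V` be an affine scheme given by the ideal `I` and `π : U → V ×_K L` an étale morphism.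
A rational point of `U` yields a point `a` of `V(L)` such that the points of `V(K)` near `a` lift
to `U(F)`, for all Henselian valued extensions `F` of `L`. -/
theorem ScaledValuedExtension.exists_point_eventually_exists_lift {K L : Type u} [Field K] [Field L]
    [Algebra K L] {n : ℕ} {I : Ideal (MvPolynomial (Fin n) K)} {V : Scheme.{u}}
    {p : V ⟶ Spec (.of K)} (e : V ≅ Spec (.of (MvPolynomial (Fin n) K ⧸ I)))
    (he : e.hom ≫ Spec.map (CommRingCat.ofHom (algebraMap K (MvPolynomial (Fin n) K ⧸ I))) = p)
    {U : Scheme.{u}} (q : U ⟶ Spec (.of L))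
    (π : U ⟶ pullback p (Spec.map (CommRingCat.ofHom (algebraMap K L)))) [Etale π]
    (hπ : π ≫ pullback.snd _ _ = q) (b : Spec (.of L) ⟶ U) (hb : b ≫ q = 𝟙 _) :
    ∃ a : Fin n → L, a ∈ MvPolynomial.zeroLocus L I ∧
      ∀ᶠ E in smallRadius L, HenselianLocalRing E.ring → ∀ (y : Fin n → K)
        (hy : ∀ f ∈ I, MvPolynomial.eval y f = 0),
        E.IsClose a (fun j ↦ E.emb (algebraMap K L (y j))) →
        ∃ b' : Spec (.of E.carrier) ⟶ U, b' ≫ q = Spec.map (CommRingCat.ofHom E.emb) ∧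
          b' ≫ π ≫ pullback.fst _ _ =
            Spec.map (CommRingCat.ofHom (E.emb.comp (algebraMap K L))) ≫
              Spec.map (CommRingCat.ofHom (Ideal.Quotient.lift I (MvPolynomial.eval y) hy)) ≫
                e.inv := by
  obtain ⟨A, _, φ, ιV, c, hφ, hφK, hcL, hcV, hlift⟩ := exists_iso_spec_pullback (L := L)
    (Ideal.Quotient.mkₐ K I) (Ideal.Quotient.mkₐ_surjective K I) e he
  replace hφK : φ.comp (MvPolynomial.map (algebraMap K L)) = ιV.comp (Ideal.Quotient.mk I) := hφK
  obtain ⟨θ, hθ⟩ := Spec.map_surjective (b ≫ π ≫ c.hom)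
  have hθL : θ.hom.comp (φ.comp MvPolynomial.C) = RingHom.id L := by
    have : CommRingCat.ofHom (φ.comp MvPolynomial.C) ≫ θ = 𝟙 _ := by
      apply Spec.map_injective
      rw [Spec.map_comp, hθ, Category.assoc, Category.assoc, hcL, hπ, hb, Spec.map_id]
    exact congrArg CommRingCat.Hom.hom this
  let a : Fin n → L := fun j ↦ θ.hom (φ (.X j))
  have ha : θ.hom.comp φ = MvPolynomial.eval a := by
    refine MvPolynomial.ringHom_ext (fun r ↦ ?_) fun j ↦ ?_
    · simpa using RingHom.congr_fun hθL r
    · simp [a]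
  refine ⟨a, fun f hf ↦ ?_, ?_⟩
  · rw [MvPolynomial.aeval_def, ← MvPolynomial.eval_map, ← ha, RingHom.comp_apply,
      ← RingHom.comp_apply φ, hφK, RingHom.comp_apply, Ideal.Quotient.eq_zero_iff_mem.2 hf, map_zero, map_zero]
  filter_upwards [eventually_exists_lift_of_etale_morphism φ hφ (π ≫ c.hom) b θ.hom
    (by rw [← hθ]; rfl) a ha] with E hE hH y hy hclose
  set ev : MvPolynomial (Fin n) K ⧸ I →+* K := Ideal.Quotient.lift I (MvPolynomial.eval y) hy
  have hev : ev.comp (algebraMap K _) = RingHom.id K := by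
    ext r
    change ev (Ideal.Quotient.mk I (.C r)) = r
    simp [ev]
  obtain ⟨ψ, hψV, hψL⟩ := hlift E.carrier E.emb ((E.emb.comp (algebraMap K L)).comp ev)
    (by rw [RingHom.comp_assoc, hev, RingHom.comp_id])
  obtain ⟨b', hb'⟩ := hE hH ψ hψL (by
    convert hclose using 2 with j
    have h1 := RingHom.congr_fun hφK (.X j)
    have h2 := RingHom.congr_fun hψV (Ideal.Quotient.mk I (.X j))
    simp only [RingHom.comp_apply, MvPolynomial.map_X] at h1 h2
    rw [h1, h2]
    simp [ev])
  refine ⟨b', ?_, ?_⟩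
  · rw [← hπ, ← hcL, reassoc_of% hb', ← Spec.map_comp, ← CommRingCat.ofHom_comp,
      hψL]
  · rw [← cancel_mono e.hom]
    simp only [Category.assoc, Iso.inv_hom_id, Category.comp_id]
    rw [← hcV, reassoc_of% hb', ← Spec.map_comp, ← Spec.map_comp,
      ← CommRingCat.ofHom_comp, ← CommRingCat.ofHom_comp, hψV]

end

/-! ### Values in algebraic extensions -/

/-- In an algebraic extension the values of the smaller field are cofinal. -/
theorem exists_valuation_algebraMap_le {K F : Type*} [Field K] [Field F] [Algebra K F]
    [Algebra.IsAlgebraic K F] (O : ValuationSubring F) (β : F) (hβ : β ≠ 0) :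
    ∃ d : K, d ≠ 0 ∧ O.valuation (algebraMap K F d) ≤ O.valuation β := by
  by_cases h1 : 1 ≤ O.valuation β
  · exact ⟨1, one_ne_zero, by simpa using h1⟩
  rw [not_le] at h1
  let m := minpoly K β
  have hint : IsIntegral K β := Algebra.IsIntegral.isIntegral β
  have hm0 : m.coeff 0 ≠ 0 := minpoly.coeff_zero_ne_zero hint hβ
  obtain ⟨k, -, hk⟩ := Finset.exists_max_image (Finset.range (m.natDegree + 1))
    (fun k ↦ O.valuation (algebraMap K F (m.coeff k))) ⟨0, by simp⟩
  have hk' : ∀ l, O.valuation (algebraMap K F (m.coeff l)) ≤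
      O.valuation (algebraMap K F (m.coeff k)) := fun l ↦ by
    by_cases hl : l ∈ Finset.range (m.natDegree + 1)
    · exact hk l hl
    · rw [Polynomial.coeff_eq_zero_of_natDegree_lt (by simpa using hl)]
      simp
  have hmk : m.coeff k ≠ 0 := fun h ↦ by
    have := hk' 0
    rw [h, map_zero, map_zero, le_zero_iff, map_eq_zero, map_eq_zero] at this
    exact hm0 this
  refine ⟨m.coeff 0 / m.coeff k, div_ne_zero hm0 hmk, ?_⟩
  have hpos : 0 < O.valuation (algebraMap K F (m.coeff k)) := zero_lt_iff.2 (by simpa using hmk)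
  rw [map_div₀, map_div₀, div_le_iff₀ hpos]
  -- `m(0) = -β · (m(β) - m(0)) / β`, and the last factor has value at most `|m.coeff k|`
  have hroot : Polynomial.aeval β m.divX * β + algebraMap K F (m.coeff 0) = 0 := by
    have h := minpoly.aeval K β
    change Polynomial.aeval β m = 0 at h
    rw [← Polynomial.divX_mul_X_add m] at h
    simpa using h
  rw [eq_neg_of_add_eq_zero_right hroot, Valuation.map_neg, map_mul, mul_comm]
  gcongr
  rw [Polynomial.aeval_eq_sum_range]
  refine Valuation.map_sum_le _ fun l _ ↦ ?_
  rw [Algebra.smul_def, map_mul, map_pow, Polynomial.coeff_divX]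
  exact (mul_le_of_le_one_right' (pow_le_one' h1.le l)).trans (hk' _)

theorem exists_forall_valuation_algebraMap_le {K F ι : Type*} [Field K] [Field F] [Algebra K F]
    [Algebra.IsAlgebraic K F] (O : ValuationSubring F) (D : Finset ι) (β : ι → F)
    (hβ : ∀ i, β i ≠ 0) :
    ∃ d : K, d ≠ 0 ∧ ∀ i ∈ D, O.valuation (algebraMap K F d) ≤ O.valuation (β i) := by
  choose d hd hle using fun i ↦ exists_valuation_algebraMap_le (K := K) O (β i) (hβ i)
  obtain rfl | hne := D.eq_empty_or_nonempty
  · exact ⟨1, one_ne_zero, by simp⟩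
  obtain ⟨i, -, hi⟩ := D.exists_min_image (fun i ↦ O.valuation (algebraMap K F (d i))) hne
  exact ⟨d i, hd i, fun j hj ↦ (hi j hj).trans (hle j)⟩

/-! ### Subdivision of special partitions -/

section

variable {K : Type u} [Field K] {X : Type v} [TopologicalSpace X]
  [CompactSpace X] [T2Space X] [TotallyDisconnectedSpace X]
  [MulAction (AbsGal K) X] [ContinuousSMul (AbsGal K) X]

theorem SpecialPartition.smul_mem_block {S : FieldStructure K X} {ι : Type}
    (P : SpecialPartition S ι) {i : ι} {σ : AbsGal K} (hσ : σ ∈ (P.L i).fixingSubgroup) {x : X}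
    (hx : x ∈ P.block i) : σ • x ∈ P.block i :=
  ((P.mem_fixingSubgroup_iff i σ).1 hσ).subset ⟨x, hx, rfl⟩

/-- A nonempty block meets none of its translates by elements outside its stabilizer. -/
theorem SpecialPartition.mem_fixingSubgroup_of_smul_mem {S : FieldStructure K X} {ι : Type}
    (P : SpecialPartition S ι) {i : ι} {σ : AbsGal K} {x : X} (hx : x ∈ P.block i)
    (hσx : σ • x ∈ P.block i) : σ ∈ (P.L i).fixingSubgroup := by
  obtain ⟨R, hR, hRX⟩ := P.exists_representatives
  obtain ⟨ρ, ⟨hρ, hρσ⟩, -⟩ := hR i σ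
  obtain ⟨ρ', ⟨hρ', hρ'1⟩, -⟩ := hR i 1
  rw [mul_one] at hρ'1
  have h1 : σ • x ∈ (fun y ↦ ρ • y) '' P.block i :=
    ⟨(ρ⁻¹ * σ) • x, P.smul_mem_block hρσ hx, by simp [smul_smul]⟩
  have h2 : σ • x ∈ (fun y ↦ ρ' • y) '' P.block i :=
    ⟨ρ'⁻¹ • σ • x, P.smul_mem_block hρ'1 hσx, by simp⟩
  have h := (hRX (σ • x)).unique (y₁ := (i, ρ)) (y₂ := (i, ρ')) ⟨hρ, h1⟩ ⟨hρ', h2⟩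
  rw [Prod.mk.injEq] at h
  rw [← h.2] at hρ'1
  simpa using mul_mem (inv_mem hρ'1) hρσ

/-- Subdivision of the blocks of a special partition into nonempty clopen pieces that are stable
under the stabilizers of the blocks. The fields `L_i` and the representatives are unchanged. -/
def SpecialPartition.subdivide {S : FieldStructure K X} {ι ι' : Type} [Finite ι']
    (P : SpecialPartition S ι) (r : ι' → ι) (B : ι' → Set X) (hclopen : ∀ j, IsClopen (B j))
    (hne : ∀ j, (B j).Nonempty) (hsub : ∀ j, B j ⊆ P.block (r j))
    (hsmul : ∀ j, ∀ σ ∈ (P.L (r j)).fixingSubgroup, ∀ x ∈ B j, σ • x ∈ B j)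
    (hex : ∀ i, ∀ x ∈ P.block i, ∃! j, r j = i ∧ x ∈ B j) : SpecialPartition S ι' where
  finite := inferInstance
  L j := P.L (r j)
  block := B
  isClopen_block := hclopen
  finiteDimensional j := P.finiteDimensional (r j)
  le_field j x hx := P.le_field (r j) x (hsub j hx)
  mem_fixingSubgroup_iff j σ := by
    constructor
    · intro hσ
      refine Set.Subset.antisymm ?_ fun x hx ↦ ⟨σ⁻¹ • x, hsmul j _ (inv_mem hσ) x hx, by simp⟩
      rintro _ ⟨x, hx, rfl⟩
      exact hsmul j σ hσ x hx
    · intro h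
      obtain ⟨x, hx⟩ := hne j
      exact P.mem_fixingSubgroup_of_smul_mem (hsub j hx) (hsub j (h.subset ⟨x, hx, rfl⟩))
  exists_representatives := by
    obtain ⟨R, hR, hRX⟩ := P.exists_representatives
    refine ⟨fun j ↦ R (r j), fun j ↦ hR (r j), fun x ↦ ?_⟩
    obtain ⟨⟨i, ρ⟩, ⟨hρ, y, hy, hyx⟩, huniq⟩ := hRX x
    obtain ⟨j, ⟨rfl, hyj⟩, hj⟩ := hex i y hy
    refine ⟨(j, ρ), ⟨hρ, y, hyj, hyx⟩, ?_⟩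
    rintro ⟨j', ρ'⟩ ⟨hρ', y', hy', hy'x⟩
    have h := huniq (r j', ρ') ⟨hρ', y', hsub j' hy', hy'x⟩
    simp only [Prod.mk.injEq] at h
    obtain ⟨hr, rfl⟩ := h
    have hyy : y' = y := smul_left_cancel ρ' (hy'x.trans hyx.symm)
    rw [hj j' ⟨hr, hyy ▸ hy'⟩]

/-- The set of points of a block at which an element of `L_i` is integral. -/
def FieldValuationStructure.integralLocus (S : FieldValuationStructure K X) {ι : Type}
    (P : SpecialPartition S.toFieldStructure ι) (i : ι) (u : P.L i) : Set X :=
  {x | ∃ hx : x ∈ P.block i, IntermediateField.inclusion (P.le_field i x hx) u ∈ S.val x}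

theorem FieldValuationStructure.isClopen_integralLocus (S : FieldValuationStructure K X) {ι : Type}
    (P : SpecialPartition S.toFieldStructure ι) (i : ι) (u : P.L i) :
    IsClopen (S.integralLocus P i u) := by
  let := patchTopology (P.L i)
  have hcont := S.continuous_restrict (P.L i) (P.finiteDimensional i)
  set g : {x : X // P.L i ≤ S.field x} → ValuationSubring (P.L i) :=
    fun x ↦ (S.val x.1).comap (IntermediateField.inclusion x.2).toRingHom
  have hopen : IsOpen {x : X | P.L i ≤ S.field x} := S.isOpen_setOf_le _ (P.finiteDimensional i)
  have h1 : IsOpen {w : ValuationSubring (P.L i) | u ∈ w} := by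
    refine TopologicalSpace.isOpen_generateFrom_of_mem (.inr ⟨u, ?_⟩)
    ext w
    exact (w.valuation_le_one_iff u).symm
  have h2 : IsOpen {w : ValuationSubring (P.L i) | u ∉ w} := by
    by_cases hu : u = 0
    · convert isOpen_empty
      ext w
      simp [hu, zero_mem]
    refine TopologicalSpace.isOpen_generateFrom_of_mem (.inl ⟨u⁻¹, ?_⟩)
    ext w
    rw [Set.mem_ofPred_eq, Set.mem_ofPred_eq, ← w.valuation_le_one_iff, not_le, map_inv₀,
      inv_lt_one₀ (zero_lt_iff.2 (by simpa using hu))]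
  have h1' := hopen.isOpenMap_subtype_val _ (h1.preimage hcont)
  have h2' := hopen.isOpenMap_subtype_val _ (h2.preimage hcont)
  constructor
  · rw [← isOpen_compl_iff]
    convert (P.isClopen_block i).compl.isOpen.union h2'
    ext x
    by_cases hx : x ∈ P.block i
    · simp [integralLocus, hx, g, P.le_field i x hx]
    · simp [integralLocus, hx]
  · convert (P.isClopen_block i).isOpen.inter h1'
    ext x
    by_cases hx : x ∈ P.block i
    · simp [integralLocus, hx, g, P.le_field i x hx]
    · simp [integralLocus, hx]

/-- Elements of `L_i` are fixed by `Gal(L_i)`, so their integrality is invariant. -/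
theorem FieldValuationStructure.smul_mem_integralLocus (S : FieldValuationStructure K X) {ι : Type}
    (P : SpecialPartition S.toFieldStructure ι) (i : ι) (u : P.L i) {σ : AbsGal K}
    (hσ : σ ∈ (P.L i).fixingSubgroup) {x : X} (hx : x ∈ S.integralLocus P i u) :
    σ • x ∈ S.integralLocus P i u := by
  obtain ⟨hx, hu⟩ := hx
  have hσx := P.smul_mem_block hσ hx
  refine ⟨hσx, ?_⟩
  have hfix : σ (u : SeparableClosure K) = u := hσ u
  have hmem : σ ((IntermediateField.inclusion (P.le_field i x hx) u : S.field x) :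
      SeparableClosure K) ∈ S.field (σ • x) := by
    change σ (u : SeparableClosure K) ∈ _
    rw [hfix]
    exact P.le_field i _ hσx u.2
  have := (S.val_smul σ x _ hmem).2 hu
  convert this using 1
  exact Subtype.ext hfix.symm

/-- After a subdivision of the blocks of a special partition, there are elements of `Kˣ`, one for
each block, which are small on the block with respect to finitely many elements of `L_iˣ`. -/
theorem FieldValuationStructure.exists_subdivision (S : FieldValuationStructure K X) {ι : Type}
    (P : SpecialPartition S.toFieldStructure ι) (D : ∀ i, Finset (P.L i)ˣ) :
    ∃ (ι' : Type) (_ : Finite ι') (r : ι' → ι) (B : ι' → Set X) (d : ι' → Kˣ),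
      (∀ j, IsClopen (B j)) ∧ (∀ j, (B j).Nonempty) ∧ (∀ j, B j ⊆ P.block (r j)) ∧
      (∀ j, ∀ σ ∈ (P.L (r j)).fixingSubgroup, ∀ x ∈ B j, σ • x ∈ B j) ∧
      (∀ i, ∀ x ∈ P.block i, ∃! j, r j = i ∧ x ∈ B j) ∧
      ∀ j, ∀ x (hx : x ∈ P.block (r j)), x ∈ B j → ∀ β ∈ D (r j),
        (S.val x).valuation (algebraMap K (S.field x) (d j)) ≤
          (S.val x).valuation
            (IntermediateField.inclusion (P.le_field (r j) x hx) (β : P.L (r j))) := by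
  have := P.finite
  -- the part of a block on which `d` is small; it is defined by integrality of elements of `L_i`,
  -- so it is clopen and stable under `Gal(L_i)`
  let N (i : ι) (d : Kˣ) : Set X :=
    P.block i ∩ ⋂ β ∈ D i, S.integralLocus P i (algebraMap K (P.L i) d / (β : P.L i))
  have hN : ∀ i d, IsClopen (N i d) := fun i d ↦ (P.isClopen_block i).inter
    (isClopen_biInter_finset fun β _ ↦ S.isClopen_integralLocus P i _)
  have hNsmul : ∀ i d, ∀ σ ∈ (P.L i).fixingSubgroup, ∀ x ∈ N i d, σ • x ∈ N i d := by
    rintro i d σ hσ x ⟨hx, hx'⟩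
    refine ⟨P.smul_mem_block hσ hx, ?_⟩
    simp only [Set.mem_iInter] at hx' ⊢
    exact fun β hβ ↦ S.smul_mem_integralLocus P i _ hσ (hx' β hβ)
  have hNval : ∀ i d x (hx : x ∈ P.block i), x ∈ N i d ↔ ∀ β ∈ D i,
      (S.val x).valuation (algebraMap K (S.field x) d) ≤
        (S.val x).valuation (IntermediateField.inclusion (P.le_field i x hx) (β : P.L i)) := by
    intro i d x hx
    have hiff : ∀ β : (P.L i)ˣ, x ∈ S.integralLocus P i (algebraMap K (P.L i) d / (β : P.L i)) ↔
        (S.val x).valuation (algebraMap K (S.field x) d) ≤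
          (S.val x).valuation (IntermediateField.inclusion (P.le_field i x hx) (β : P.L i)) := by
      intro β
      have hpos : 0 < (S.val x).valuation
          (IntermediateField.inclusion (P.le_field i x hx) (β : P.L i)) :=
        zero_lt_iff.2 (by simp)
      rw [FieldValuationStructure.integralLocus, Set.mem_ofPred_eq, exists_prop_of_true hx,
        ← ValuationSubring.valuation_le_one_iff, map_div₀, map_div₀, div_le_one₀ hpos]
      rw [AlgHom.commutes]
    simp only [N, Set.mem_inter_iff, hx, true_and, Set.mem_iInter, hiff]
  have hcover : ∀ i, P.block i ⊆ ⋃ d, N i d := by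
    intro i x hx
    obtain ⟨d, hd, hle⟩ := exists_forall_valuation_algebraMap_le (K := K) (S.val x) (D i)
      (fun β ↦ IntermediateField.inclusion (P.le_field i x hx) (β : P.L i)) (by simp)
    exact Set.mem_iUnion.2 ⟨Units.mk0 d hd, (hNval i _ x hx).2 hle⟩
  have hfin : ∀ i, ∃ (m : ℕ) (d : Fin m → Kˣ), P.block i ⊆ ⋃ k, N i (d k) := by
    intro i
    obtain ⟨t, ht⟩ := (P.isClopen_block i).isClosed.isCompact.elim_finite_subcover _
      (fun d ↦ (hN i d).isOpen) (hcover i)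
    refine ⟨t.card, fun k ↦ t.equivFin.symm k, fun x hx ↦ ?_⟩
    obtain ⟨d, hd, hxd⟩ := Set.mem_iUnion₂.1 (ht hx)
    exact Set.mem_iUnion.2 ⟨t.equivFin ⟨d, hd⟩, by simpa using hxd⟩
  choose m d hmd using hfin
  -- the finitely many sets covering a block are made disjoint, and the empty ones are dropped:
  -- the stabilizer of an empty block would be the whole Galois group
  let B (j : Σ i, Fin (m i)) : Set X := N j.1 (d j.1 j.2) \ ⋃ k ∈ Set.Iio j.2, N j.1 (d j.1 k)
  refine ⟨{j : Σ i, Fin (m i) // (B j).Nonempty}, inferInstance, fun j ↦ j.1.1, fun j ↦ B j.1,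
    fun j ↦ d j.1.1 j.1.2, fun j ↦ ?_, fun j ↦ j.2, fun j x hx ↦ hx.1.1, fun j σ hσ x hx ↦ ?_,
    fun i x hx ↦ ?_, fun j x hx hxj ↦ (hNval _ _ x hx).1 hxj.1⟩
  · exact (hN _ _).diff ((Set.toFinite _).isClopen_biUnion fun k _ ↦ hN _ _)
  · refine ⟨hNsmul _ _ σ hσ x hx.1, fun hcon ↦ hx.2 ?_⟩
    obtain ⟨k, hk, hxk⟩ := Set.mem_iUnion₂.1 hcon
    exact Set.mem_iUnion₂.2 ⟨k, hk, by simpa using hNsmul _ _ σ⁻¹ (inv_mem hσ) _ hxk⟩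
  · obtain ⟨k, hk, hmin⟩ := wellFounded_lt.has_min {k : Fin (m i) | x ∈ N i (d i k)}
      (Set.mem_iUnion.1 (hmd i hx))
    have hxB : x ∈ B ⟨i, k⟩ := ⟨hk, fun hcon ↦ by
      obtain ⟨l, hl, hxl⟩ := Set.mem_iUnion₂.1 hcon
      exact hmin l hxl hl⟩
    refine ⟨⟨⟨i, k⟩, ⟨x, hxB⟩⟩, ⟨rfl, hxB⟩, ?_⟩
    rintro ⟨⟨i', k'⟩, hne⟩ ⟨rfl, hx'⟩
    have h1 : ¬ k' < k := hmin k' hx'.1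
    have h2 : ¬ k < k' := fun h ↦ hx'.2 (Set.mem_iUnion₂.2 ⟨k, h, hk⟩)
    obtain rfl : k' = k := le_antisymm (not_lt.1 h2) (not_lt.1 h1)
    rfl

end

end BlockApprox

/-! ### Block approximation implies unirational closedness -/

open AlgebraicGeometry CategoryTheory CategoryTheory.Limits BlockApprox in
theorem proposition12p4 {K : Type u} [Field K] [Infinite K]
    {X : Type v} [TopologicalSpace X] [CompactSpace X] [T2Space X] [TotallyDisconnectedSpace X]
    [MulAction (BlockApprox.AbsGal K) X] [ContinuousSMul (BlockApprox.AbsGal K) X]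
    (S : BlockApprox.FieldValuationStructure K X)
    (hHensel : S.IsHenselian) (hBlock : S.BlockApproximationCondition) :
    S.toFieldStructure.UnirationallyClosed := by
  intro Φ
  have := Φ.isAffine_V
  have := Φ.smooth_V
  have := Φ.etale_π
  have := Φ.isVariety_V.geometricallyIntegral
  have := Φ.isVariety_V.locallyOfFiniteType
  have := Φ.isVariety_V.quasiCompact
  have : MorphismProperty.RespectsIso @GeometricallyIntegral.{u} :=
    MorphismProperty.IsStableUnderBaseChange.respectsIso
  let P := Φ.partition
  obtain ⟨n, I, e, he⟩ := exists_iso_spec_mvPolynomial_quotient Φ.p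
  have he' : Spec.map (CommRingCat.ofHom (algebraMap K (MvPolynomial (Fin n) K ⧸ I))) =
      e.inv ≫ Φ.p := by rw [← he, Iso.inv_hom_id_assoc]
  have hpoint : ∀ i, ∃ b : Spec (.of (P.L i)) ⟶ Φ.U i, b ≫ Φ.q i = 𝟙 _ := fun i ↦ by
    have : Infinite (P.L i) := .of_injective _ (algebraMap K (P.L i)).injective
    exact exists_section_of_birationalOver_affineSpace _ (Φ.birational_U i)
  -- the points `a i` are the images in `V` of rational points of the varieties `U i`
  choose b₀ hb₀ using hpoint
  choose a ha hev using fun i ↦ ScaledValuedExtension.exists_point_eventually_exists_lift e he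
    (Φ.q i) (Φ.π i) (Φ.π_snd i) (b₀ i) (hb₀ i)
  choose D hD using fun i ↦ ScaledValuedExtension.eventually_smallRadius_iff.1 (hev i)
  obtain ⟨ι', _, r, B, d, hclopen, hne, hsub, hsmul, hex, hsmall⟩ := S.exists_subdivision P D
  -- closeness is measured by the fourth power of the radius
  obtain ⟨sol⟩ := hBlock
    { ι := ι'
      partition := P.subdivide r B hclopen hne hsub hsmul hex
      n := n
      I := I
      isVariety_V := by
        rw [he']
        exact ⟨(MorphismProperty.cancel_left_of_respectsIso (P := @GeometricallyIntegral) _ _).2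
          ‹_›, inferInstance, inferInstance⟩
      smooth_V := by
        rw [he']
        infer_instance
      a := fun j ↦ a (r j)
      a_mem := fun j ↦ ha (r j)
      c := fun j ↦ (d j : K) ^ 4
      c_ne_zero := fun j ↦ pow_ne_zero 4 (d j).ne_zero }
  have hy : ∀ f ∈ I, MvPolynomial.eval sol.b f = 0 := fun f hf ↦ sol.b_mem f hf
  let ev : MvPolynomial (Fin n) K ⧸ I →+* K := Ideal.Quotient.lift I (MvPolynomial.eval sol.b) hy
  have hevK : ev.comp (algebraMap K _) = RingHom.id K := by
    ext c
    change ev (Ideal.Quotient.mk I (.C c)) = c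
    simp [ev]
  have hlift : ∀ i, ∀ x (hx : x ∈ P.block i), ∃ b : Spec (.of (S.field x)) ⟶ Φ.U i,
      b ≫ Φ.q i = Spec.map (CommRingCat.ofHom
        (IntermediateField.inclusion (P.le_field i x hx)).toRingHom) ∧
      b ≫ Φ.π i ≫ pullback.fst _ _ =
        Spec.map (CommRingCat.ofHom (algebraMap K (S.field x))) ≫
          Spec.map (CommRingCat.ofHom ev) ≫ e.inv := by
    intro i x hx
    obtain ⟨j, ⟨rfl, hxj⟩, -⟩ := hex i x hx
    let E : ScaledValuedExtension (P.L (r j)) :=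
      { carrier := S.field x
        emb := (IntermediateField.inclusion (P.le_field _ x hx)).toRingHom
        ring := S.val x
        scale := algebraMap K (S.field x) (d j)
        scale_ne_zero := by simp }
    refine hD (r j) E (hsmall j x hx hxj) (hHensel x) sol.b hy fun k ↦ ?_
    have := sol.approx j x hxj k
    rw [map_pow] at this
    exact this
  choose b hbq hbπ using hlift
  exact ⟨{
    a := Spec.map (CommRingCat.ofHom ev) ≫ e.inv
    a_over := by
      rw [Category.assoc, ← he', ← Spec.map_comp, ← CommRingCat.ofHom_comp, hevK]
      exact Spec.map_id _
    b := b
    b_over := hbq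
    π_b := hbπ }⟩
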